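/- **Setting.** On Fock vectors $\psi=(\psi^{(n)})_{n\ge 0}$, $\psi^{(n)}:\mathbb R^n\to\mathbb C$, with $\langle\psi,\varphi\rangle=\sum_n\int_{\mathbb R^n}\overline{\psi^{(n)}}\varphi^{(n)}$, let $(b_t\psi)^{(n)}(s_1,\dots,s_n)=\sqrt{n+1}\,\psi^{(n+1)}(t,s_1,\dots,s_n)$, and let $b_t^\dagger$ be its formal adjoint, with $[b_t,b_s^\dagger]=\delta(t-s)$ and $[b_t,b_s]=[b_t^\dagger,b_s^\dagger]=0$. Exponential vectors are $\psi(u)=(u^{\otimes n}/\sqrt{n!})_{n\ge0}$, where $u:\mathbb R\to\mathbb C$ is measurable, square integrable and bounded on bounded sets. A right-continuous step function is a finite complex linear combination of indicators of intervals $[a,b)$. For integers $n\ge 2$ and $k$ and a right-continuous step function $f$ with $f(0)=0$, put $$\hat B^n_k(f)=\int_{\mathbb R} f(t)\,e^{\frac k2(b_t-b_t^\dagger)}\Big(\frac{b_t+b_t^\dagger}{2}\Big)^{n-1}e^{\frac k2(b_t-b_t^\dagger)}\,dt .$$ This, and likewise a product $\hat B^n_k(f)\hat B^N_K(h)$, which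 is the double integral against $f(t)h(s)$ of the product of the integrands at the times $t$ and $s$, is a quadratic form on exponential vectors, obtained as follows. Expand the exponential series and the powers; bring every term to normal order (all $b^\dagger$ to the left of all $b$) by the commutation relations, which produces powers of $\delta(t-s)$ and, from letters at equal times, of $\delta(0)$; renormalize by $$\delta^l(t-s)=\delta(s)\,\delta(t-s),\qquad l=2,3,\dots;$$ integrate against the test functions, where $(b_t^\dagger)^{a}(b_s^\dagger)^{a'}b_t^{c}b_s^{c'}$ has the quadratic form $\langle b_t^{a}b_s^{a'}\psi,\,b_t^{c}b_s^{c'}\varphi\rangle$; and sum over the terms of the exponential series. Here a factor $\delta(0)^i$, $i\ge1$, at time $t$ is read through the same prescription as the coefficient in $\delta^{i}(t'-t)\,\delta(t'-t)=\delta^{i+1}(t'-t)=\delta(t)\,\delta(t'-t)$, that is, as $\delta(t)$, and factors $\delta(0)$ that accompany $\delta^l(t-s)$ with $l\ge1$ are counted as further factors $\delta(t-s)$. **Proposition.** Let $f,g$ be right-continuous step functions with $f(0)=g(0)=0$. Then for all integers $n,N\ge2$ and all $k,K\in\mathbb Z$, as quadratic forms on exponential vectors, $$[\hat B^n_k(\bar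 g),\hat B^N_K(f)]=\big(k(N-1)-K(n-1)\big)\,\hat B^{n+N-2}_{k+K}(\bar g f),\qquad [x,y]:=xy-yx,$$ where all the series over the terms of the exponentials converge absolutely; that is, the $\hat B^n_k$ satisfy the commutation relations of the $w_\infty$ algebra. In particular, for $n=N=2$ they satisfy the Virasoro relations without central term: $$[\hat B^2_k(\bar g),\hat B^2_K(f)]=(k-K)\,\hat B^2_{k+K}(\bar g f).$$ -/

import Mathlib

open MeasureTheory

open scoped ComplexConjugate

noncomputable section

namespace WhiteNoise

/-! ### Test functions -/

/-- Right-continuous step functions on `ℝ`: finite complex linear combinations of indicators of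
bounded intervals `[a, b)`. -/
def IsRightContStep (f : ℝ → ℂ) : Prop :=
  f ∈ Submodule.span ℂ {h : ℝ → ℂ | ∃ a b : ℝ, h = (Set.Ico a b).indicator (fun _ => (1 : ℂ))}

/-! ### Fock vectors, the annihilation density and exponential vectors -/

/-- A Fock vector `ψ = (ψ⁽ⁿ⁾)` given by its pointwise defined components `ψ⁽ⁿ⁾(s₁, …, sₙ)`. -/
abbrev FockVec : Type := (n : ℕ) → (Fin n → ℝ) → ℂ

/-- The Fock scalar product `⟨ψ, φ⟩ = ∑ₙ ∫ conj ψ⁽ⁿ⁾ φ⁽ⁿ⁾`, antilinear on the left. -/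
def fockInner (ψ φ : FockVec) : ℂ :=
  ∑' n : ℕ, ∫ s : Fin n → ℝ, conj (ψ n s) * φ n s

/-- `(b_t ψ)⁽ⁿ⁾(s₁, …, sₙ) = √(n+1) ψ⁽ⁿ⁺¹⁾(t, s₁, …, sₙ)`. -/
def annihilate (t : ℝ) (ψ : FockVec) : FockVec :=
  fun n s => (Real.sqrt ((n : ℝ) + 1) : ℂ) * ψ (n + 1) (Fin.cons (α := fun _ => ℝ) t s)

/-- The exponential vector `ψ(u)`, with components `u^{⊗ n} / √n!`. -/
def expVec (u : ℝ → ℂ) : FockVec :=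
  fun n s => (∏ i, u (s i)) / (Real.sqrt (n.factorial : ℝ) : ℂ)

/-- The functions whose exponential vectors are used: measurable, square integrable and bounded on
bounded sets (among them all Schwartz functions and all step functions). -/
def IsExpArg (u : ℝ → ℂ) : Prop :=
  Measurable u ∧ MemLp u 2 volume ∧ ∀ R : ℝ, ∃ C : ℝ, ∀ t : ℝ, |t| ≤ R → ‖u t‖ ≤ C

/-! ### White noise words and normal ordering

`ι` labels the times that occur in an expression. -/

/-- The letters `b_{t_i}` and `b_{t_i}^†`. -/
inductive Gen (ι : Type) : Type
  | ann (i : ι) : Gen ι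
  | cre (i : ι) : Gen ι

/-- The (commuting) symbols occurring in normally ordered expressions: the letters, and the symbols
`δ(t_i - t_j) = δ(t_j - t_i)`. -/
abbrev Var (ι : Type) : Type := Gen ι ⊕ Sym2 ι

/-- Normally ordered expressions: the monomial with exponents `d` stands for the product of the
`δ(t_i - t_j)^{d(δ_ij)}`, followed by all `b_{t_i}^†`, followed by all `b_{t_i}`. -/
abbrev NormalExpr (ι : Type) : Type := MvPolynomial (Var ι) ℂ

/-- The letters of a normally ordered expression. -/
def symAnn {ι : Type} (i : ι) : Var ι := Sum.inl (Gen.ann i)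

/-- See `symAnn`. -/
def symCre {ι : Type} (i : ι) : Var ι := Sum.inl (Gen.cre i)

/-- The symbol `δ(t_i - t_j)`. -/
def symDelta {ι : Type} (i j : ι) : Var ι := Sum.inr s(i, j)

/-- Left multiplication of a normally ordered expression by a letter, brought back to normal order
with the commutation relations `[b_{t_i}, b_{t_j}^†] = δ(t_i - t_j)`,
`[b_{t_i}, b_{t_j}] = [b_{t_i}^†, b_{t_j}^†] = 0`. -/
def leftMul {ι : Type} [Fintype ι] : Gen ι → Module.End ℂ (NormalExpr ι)
  | Gen.cre i => LinearMap.mulLeft ℂ (MvPolynomial.X (symCre i))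
  | Gen.ann i => LinearMap.mulLeft ℂ (MvPolynomial.X (symAnn i)) +
      ∑ j, LinearMap.mulLeft ℂ (MvPolynomial.X (symDelta i j)) ∘ₗ
        (MvPolynomial.pderiv (symCre j) : Derivation ℂ (NormalExpr ι) (NormalExpr ι)).toLinearMap

/-- The normally ordered form of a noncommutative polynomial in the `b_{t_i}`, `b_{t_i}^†`. -/
def normalOrder {ι : Type} [Fintype ι] (w : FreeAlgebra ℂ (Gen ι)) : NormalExpr ι :=
  FreeAlgebra.lift ℂ (leftMul (ι := ι)) w 1

/-- `leftMul` represents the relation `[b_{t_i}, b_{t_j}^†] = δ(t_i - t_j)`. -/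
theorem leftMul_ann_cre {ι : Type} [Fintype ι] (i j : ι) (P : NormalExpr ι) :
    leftMul (Gen.ann i) (leftMul (Gen.cre j) P) - leftMul (Gen.cre j) (leftMul (Gen.ann i) P) =
      MvPolynomial.X (symDelta i j) * P := by
  classical
  have key : ∀ x : ι,
      MvPolynomial.pderiv (symCre x)
        ((MvPolynomial.X (symCre j) : NormalExpr ι) * P) =
      MvPolynomial.X (symCre j) * MvPolynomial.pderiv (symCre x) P + if x = j then P else 0 := by
    intro x
    by_cases h : x = j
    · subst h
      simp [Derivation.leibniz]
    · have h' : symCre j ≠ symCre x := by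
        simp only [symCre, ne_eq, Sum.inl.injEq, Gen.cre.injEq]
        exact fun e => h e.symm
      simp [Derivation.leibniz, MvPolynomial.pderiv_X_of_ne h', h]
  simp only [leftMul, LinearMap.add_apply, LinearMap.mulLeft_apply, LinearMap.sum_apply,
    LinearMap.comp_apply, Derivation.coeFn_coe, key, mul_add, Finset.sum_add_distrib,
    Finset.mul_sum, mul_ite, mul_zero, Finset.sum_ite_eq', Finset.mem_univ, if_true]
  simp only [mul_left_comm (MvPolynomial.X (symCre j))]
  ring

/-! ### The expansion of the integrand -/

/-- `b_{t_i}` as a noncommutative polynomial. -/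
def ann {ι : Type} (i : ι) : FreeAlgebra ℂ (Gen ι) := FreeAlgebra.ι ℂ (Gen.ann i)

/-- `b_{t_i}^†` as a noncommutative polynomial. -/
def cre {ι : Type} (i : ι) : FreeAlgebra ℂ (Gen ι) := FreeAlgebra.ι ℂ (Gen.cre i)

/-- The term of order `p` of the exponential series of `(k/2)(b_{t_i} - b_{t_i}^†)`. -/
def expTerm {ι : Type} (i : ι) (k : ℤ) (p : ℕ) : FreeAlgebra ℂ (Gen ι) :=
  ((p.factorial : ℂ)⁻¹) • (((k : ℂ) / 2) • (ann i - cre i)) ^ p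

/-- The term of order `(p, q)` in the expansion of the two exponential series in
`e^{(k/2)(b - b^†)} ((b + b^†)/2)^{n-1} e^{(k/2)(b - b^†)}` at the time `t_i`. -/
def densityTerm {ι : Type} (i : ι) (n : ℕ) (k : ℤ) (pq : ℕ × ℕ) : FreeAlgebra ℂ (Gen ι) :=
  expTerm i k pq.1 * ((1 / 2 : ℂ) • (ann i + cre i)) ^ (n - 1) * expTerm i k pq.2

/-! ### Renormalization, integration against test functions, quadratic forms -/

/-- The factor `φ^m(s) ds` of the prescription `δ^{m+1}(t - s) = φ^m(s) δ(t - s)`, where `φ^m = δ`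
for `m ≥ 1`, that is, `δ^l(t - s) = δ(s) δ(t - s)` for `l ≥ 2`. -/
def renormFactor (m : ℕ) : Measure ℝ :=
  if m = 0 then volume else Measure.dirac 0

/-- The quadratic form of a normally ordered monomial at one time `t`, renormalized and integrated
against `f(t)`. The monomial is `δ(t - t)^i (b_t^†)^a (b_t)^c`; as the coefficient `δ(t' - t)^i` of
`δ(t' - t)` in a double integral over `t', t`, the factor `δ(t - t)^i` is read as `φ^i(t)`. The
quadratic form of `(b_t^†)^a (b_t)^c` is `⟨b_t^a ψ, b_t^c φ⟩`. -/
def monomialForm₁ (f : ℝ → ℂ) (ψ φ : FockVec) (d : Var (Fin 1) →₀ ℕ) : ℂ :=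
  ∫ t, f t * fockInner ((annihilate t)^[d (symCre 0)] ψ) ((annihilate t)^[d (symAnn 0)] φ)
    ∂(renormFactor (d (symDelta 0 0)))

/-- `⟨ψ, (b_t^†)^a (b_s^†)^{a'} (b_t)^c (b_s)^{c'} φ⟩` for the letters of a monomial at the two
times `t` (label `0`) and `s` (label `1`). -/
def twoTimeForm (ψ φ : FockVec) (d : Var (Fin 2) →₀ ℕ) (t s : ℝ) : ℂ :=
  fockInner ((annihilate t)^[d (symCre 0)] ((annihilate s)^[d (symCre 1)] ψ))
    ((annihilate t)^[d (symAnn 0)] ((annihilate s)^[d (symAnn 1)] φ))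

/-- The quadratic form of a normally ordered monomial at two times `t, s`, renormalized and
integrated against `f(t) h(s)`. The delta factors are `δ(t-t)^i δ(s-s)^j δ(t-s)^l`. If `l = 0` they
are read as `φ^i(t) φ^j(s)`. If `l ≥ 1` they are `δ^{i+j+l}(t-s) = φ^{i+j+l-1}(s) δ(t-s)`. -/
def monomialForm₂ (f h : ℝ → ℂ) (ψ φ : FockVec) (d : Var (Fin 2) →₀ ℕ) : ℂ :=
  if d (symDelta 0 1) = 0 then
    ∫ t, ∫ s, f t * h s * twoTimeForm ψ φ d t s
      ∂(renormFactor (d (symDelta 1 1))) ∂(renormFactor (d (symDelta 0 0)))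
  else
    ∫ s, f s * h s * twoTimeForm ψ φ d s s
      ∂(renormFactor (d (symDelta 0 0) + d (symDelta 1 1) + d (symDelta 0 1) - 1))

/-- Linear extension of `monomialForm₁` to normally ordered expressions. -/
def exprForm₁ (f : ℝ → ℂ) (P : NormalExpr (Fin 1)) (ψ φ : FockVec) : ℂ :=
  ∑ d ∈ P.support, P.coeff d * monomialForm₁ f ψ φ d

/-- Linear extension of `monomialForm₂` to normally ordered expressions. -/
def exprForm₂ (f h : ℝ → ℂ) (P : NormalExpr (Fin 2)) (ψ φ : FockVec) : ℂ :=
  ∑ d ∈ P.support, P.coeff d * monomialForm₂ f h ψ φ d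

/-! ### The operators and their products as quadratic forms -/

/-- The terms of the expansion of `⟨ψ, B̂ⁿ_k(f) φ⟩`: expand, bring to normal order, renormalize,
integrate against `f`. -/
def BhatTerm (n : ℕ) (k : ℤ) (f : ℝ → ℂ) (ψ φ : FockVec) (pq : ℕ × ℕ) : ℂ :=
  exprForm₁ f (normalOrder (densityTerm 0 n k pq)) ψ φ

/-- `⟨ψ, B̂ⁿ_k(f) φ⟩`, where `B̂ⁿ_k(f)` is the integral of
`f(t) e^{(k/2)(b_t - b_t^†)} ((b_t + b_t^†)/2)^{n-1} e^{(k/2)(b_t - b_t^†)}`. -/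
def Bhat (n : ℕ) (k : ℤ) (f : ℝ → ℂ) (ψ φ : FockVec) : ℂ :=
  ∑' pq : ℕ × ℕ, BhatTerm n k f ψ φ pq

/-- The terms of the expansion of `⟨ψ, B̂ⁿ_k(f) B̂ᴺ_K(h) φ⟩`: the product of the integrands, the
first at time `t` and the second at time `s`, is expanded, brought to normal order, renormalized and
integrated against `f(t) h(s)`. -/
def BhatMulTerm (n : ℕ) (k : ℤ) (f : ℝ → ℂ) (N : ℕ) (K : ℤ) (h : ℝ → ℂ) (ψ φ : FockVec)
    (r : (ℕ × ℕ) × (ℕ × ℕ)) : ℂ :=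
  exprForm₂ f h (normalOrder (densityTerm 0 n k r.1 * densityTerm 1 N K r.2)) ψ φ

/-- `⟨ψ, B̂ⁿ_k(f) B̂ᴺ_K(h) φ⟩`. -/
def BhatMul (n : ℕ) (k : ℤ) (f : ℝ → ℂ) (N : ℕ) (K : ℤ) (h : ℝ → ℂ) (ψ φ : FockVec) : ℂ :=
  ∑' r : (ℕ × ℕ) × (ℕ × ℕ), BhatMulTerm n k f N K h ψ φ r

/-- `⟨ψ, [B̂ⁿ_k(f), B̂ᴺ_K(h)] φ⟩` with `[x, y] = x y - y x`. -/
def BhatComm (n : ℕ) (k : ℤ) (f : ℝ → ℂ) (N : ℕ) (K : ℤ) (h : ℝ → ℂ) (ψ φ : FockVec) : ℂ :=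
  BhatMul n k f N K h ψ φ - BhatMul N K h n k f ψ φ

end WhiteNoise

end

/-
Between exponential vectors `ψ(u)` and `ψ(v)` the letters `b_t` and `b_t^†` of a normally
ordered expression become the numbers `x = v(t)` and `y = conj u(t)`, so that the density of
`B̂ⁿ_k` acquires the symbol `σ_{n,k}(x, y) = e^{k(x - y)} ((x + y)/2)^{n-1}`. Bringing a product
of a word at the time `t` and a word at the time `s` to normal order gives, on the level of
symbols, `σ₁ σ₂ + δ(t - s) ∂ₓσ₁ ∂ᵧσ₂ + …`, and since the test functions vanish at `0`, the
renormalization annihilates all terms with a further delta factor. The terms without `δ(t - s)`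
cancel in the commutator, which is therefore the integral of the test functions against the
Poisson bracket `∂ₓσ₁ ∂ᵧσ₂ - ∂ₓσ₂ ∂ᵧσ₁`, and
`{σ_{n,k}, σ_{N,K}} = (k(N-1) - K(n-1)) σ_{n+N-2,k+K}`. All estimates reduce to normal convergence
of the exponential series on compact sets of values `(x, y)`.
-/

noncomputable section

namespace WhiteNoise

/-! ### Symbols of words -/

lemma map_lift_apply_of_mem_adjoin {𝕜 G V R : Type*} [CommSemiring 𝕜] [AddCommMonoid V]
    [Module 𝕜 V] [Semiring R] [Algebra 𝕜 R] {Φ : V →ₗ[𝕜] R} {L : G → Module.End 𝕜 V} {z : G → R}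
    {s : Set G} (hΦ : ∀ g ∈ s, ∀ P, Φ (L g P) = z g * Φ P) {w : FreeAlgebra 𝕜 G}
    (hw : w ∈ Algebra.adjoin 𝕜 (FreeAlgebra.ι 𝕜 '' s)) (P : V) :
    Φ (FreeAlgebra.lift 𝕜 L w P) = FreeAlgebra.lift 𝕜 z w * Φ P := by
  induction hw using Algebra.adjoin_induction generalizing P with
  | mem a ha =>
    obtain ⟨g, hg, rfl⟩ := ha
    simpa only [FreeAlgebra.lift_ι_apply] using hΦ g hg P
  | algebraMap r =>
    simp only [AlgHom.commutes, Module.algebraMap_end_apply, map_smul, Algebra.smul_def]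
  | add a b _ _ ha hb => simp only [map_add, LinearMap.add_apply, ha, hb, add_mul]
  | mul a b _ _ ha hb => simp only [map_mul, Module.End.mul_apply, ha, hb, mul_assoc]

/-- The symbol of a normally ordered expression at the values `z` of the letters: all
`δ(t_i - t_j)` are replaced by `0`. -/
def symbol {ι : Type} {R : Type*} [CommRing R] [Algebra ℂ R] (z : Gen ι → R) :
    NormalExpr ι →ₐ[ℂ] R :=
  MvPolynomial.aeval (Sum.elim z 0)

section Symbol

variable {ι : Type} {R : Type*} [CommRing R] [Algebra ℂ R] (z : Gen ι → R) (i j : ι)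

@[simp] lemma symbol_symAnn : symbol z (MvPolynomial.X (symAnn i)) = z (Gen.ann i) := by
  simp [symbol, symAnn]

@[simp] lemma symbol_symCre : symbol z (MvPolynomial.X (symCre i)) = z (Gen.cre i) := by
  simp [symbol, symCre]

@[simp] lemma symbol_symDelta : symbol z (MvPolynomial.X (symDelta i j)) = 0 := by
  simp [symbol, symDelta]

variable [Fintype ι]

lemma leftMul_cre_apply (P : NormalExpr ι) :
    leftMul (Gen.cre i) P = MvPolynomial.X (symCre i) * P := rfl

lemma leftMul_ann_apply (P : NormalExpr ι) :
    leftMul (Gen.ann i) P = MvPolynomial.X (symAnn i) * P +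
      ∑ j, MvPolynomial.X (symDelta i j) * MvPolynomial.pderiv (symCre j) P := by
  simp [leftMul]

lemma symbol_leftMul (g : Gen ι) (P : NormalExpr ι) :
    symbol z (leftMul g P) = z g * symbol z P := by
  cases g <;> simp [leftMul_ann_apply, leftMul_cre_apply]

lemma symbol_lift_leftMul (w : FreeAlgebra ℂ (Gen ι)) (P : NormalExpr ι) :
    symbol z (FreeAlgebra.lift ℂ leftMul w P) = FreeAlgebra.lift ℂ z w * symbol z P :=
  map_lift_apply_of_mem_adjoin (Φ := (symbol z).toLinearMap) (s := Set.univ)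
    (fun g _ => symbol_leftMul z g)
    (by rw [Set.image_univ, FreeAlgebra.adjoin_range_ι]; exact Algebra.mem_top) P

lemma symbol_normalOrder (w : FreeAlgebra ℂ (Gen ι)) :
    symbol z (normalOrder w) = FreeAlgebra.lift ℂ z w := by
  simp only [normalOrder, symbol_lift_leftMul, map_one, mul_one]

end Symbol

/-! ### The coefficient of one contraction -/

open TrivSqZeroExt (inl inr)
open DualNumber (eps)

lemma aeval_inl_add_single_eps {σ 𝕜 : Type*} [DecidableEq σ] [CommRing 𝕜] (a : σ → 𝕜) (v : σ)
    (P : MvPolynomial σ 𝕜) :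
    MvPolynomial.aeval (inl ∘ a + Pi.single v eps) P =
      (inl (MvPolynomial.aeval a P) + inr (MvPolynomial.aeval a (MvPolynomial.pderiv v P)) :
        DualNumber 𝕜) := by
  induction P using MvPolynomial.induction_on with
  | C c => simp [TrivSqZeroExt.algebraMap_eq_inl]
  | add P Q hP hQ =>
    ext <;> simp [hP, hQ]
  | mul_X P w hP =>
    rcases eq_or_ne w v with rfl | hw
    · ext
      · simp [hP]
      · simp [hP, Derivation.leibniz]
        ring
    · ext
      · simp [hP, hw]
      · simp [hP, Derivation.leibniz, MvPolynomial.pderiv_X_of_ne hw, hw]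
        ring

section Contraction

variable {ι : Type} (z : Gen ι → ℂ)

lemma snd_symbol_inl_add_single_eps [DecidableEq (Gen ι)] (g : Gen ι) (P : NormalExpr ι) :
    (symbol (inl ∘ z + Pi.single g eps : Gen ι → DualNumber ℂ) P).snd =
      symbol z (MvPolynomial.pderiv (Sum.inl g) P) := by
  classical
  have h : Sum.elim (inl ∘ z + Pi.single g eps : Gen ι → DualNumber ℂ) 0 =
      inl ∘ Sum.elim z (0 : Sym2 ι → ℂ) + Pi.single (Sum.inl g) eps := by
    ext (a | e) <;> simp [Pi.single_apply]
  rw [symbol, h, aeval_inl_add_single_eps]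
  simp [symbol]

/-- The derivative of an expression by `b_{t_j}^†` and, as infinitesimal part, its derivative by
`δ(t_i - t_j)`: left multiplication by a letter at the time `t_i` acts on the pair as
multiplication by a dual number. -/
def contractionJet (i j : ι) : NormalExpr ι →ₗ[ℂ] DualNumber ℂ :=
  (TrivSqZeroExt.inlAlgHom ℂ ℂ ℂ).toLinearMap ∘ₗ (symbol z).toLinearMap ∘ₗ
      (MvPolynomial.pderiv (symCre j)).toLinearMap +
    TrivSqZeroExt.inrHom ℂ ℂ ∘ₗ (symbol z).toLinearMap ∘ₗ
      (MvPolynomial.pderiv (symDelta i j)).toLinearMap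

lemma contractionJet_apply (i j : ι) (P : NormalExpr ι) :
    contractionJet z i j P = inl (symbol z (MvPolynomial.pderiv (symCre j) P)) +
      inr (symbol z (MvPolynomial.pderiv (symDelta i j) P)) := rfl

variable [Fintype ι] {i j : ι}

lemma contractionJet_leftMul_ann (P : NormalExpr ι) :
    contractionJet z i j (leftMul (Gen.ann i) P) =
      (inl (z (Gen.ann i)) + eps) * contractionJet z i j P := by
  classical
  have hcre : symAnn i ≠ symCre j := by simp [symAnn, symCre]
  have hdelta : symAnn i ≠ symDelta i j := by simp [symAnn, symDelta]
  have hcre' (l : ι) : symDelta i l ≠ symCre j := by simp [symDelta, symCre]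
  have hdelta' (l : ι) : (Pi.single (symDelta i j) 1 : Var ι → NormalExpr ι) (symDelta i l) =
      if l = j then 1 else 0 := by
    simp only [Pi.single_apply, symDelta, Sum.inr.injEq, Sym2.congr_right]
  ext <;> simp [contractionJet_apply, leftMul_ann_apply, Derivation.leibniz,
    MvPolynomial.pderiv_X_of_ne hcre, MvPolynomial.pderiv_X_of_ne hdelta,
    MvPolynomial.pderiv_X_of_ne (hcre' _), hdelta', apply_ite (symbol z)]

lemma contractionJet_leftMul_cre (hij : i ≠ j) (P : NormalExpr ι) :
    contractionJet z i j (leftMul (Gen.cre i) P) =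
      inl (z (Gen.cre i)) * contractionJet z i j P := by
  have hcre : symCre i ≠ symCre j := by simpa [symCre] using hij
  have hdelta : symCre i ≠ symDelta i j := by simp [symCre, symDelta]
  ext <;> simp [contractionJet_apply, leftMul_cre_apply, Derivation.leibniz,
    MvPolynomial.pderiv_X_of_ne hcre, MvPolynomial.pderiv_X_of_ne hdelta]

/-- The words in the letters at the time `t_i`. -/
def wordsAt (i : ι) : Subalgebra ℂ (FreeAlgebra ℂ (Gen ι)) :=
  Algebra.adjoin ℂ (FreeAlgebra.ι ℂ '' {Gen.ann i, Gen.cre i})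

lemma contractionJet_lift_leftMul [DecidableEq (Gen ι)] (hij : i ≠ j)
    {A : FreeAlgebra ℂ (Gen ι)} (hA : A ∈ wordsAt i) (P : NormalExpr ι) :
    contractionJet z i j (FreeAlgebra.lift ℂ leftMul A P) =
      FreeAlgebra.lift ℂ (inl ∘ z + Pi.single (Gen.ann i) eps : Gen ι → DualNumber ℂ) A *
        contractionJet z i j P := by
  refine map_lift_apply_of_mem_adjoin (fun g hg P => ?_) hA P
  obtain rfl | rfl := hg
  · simp [contractionJet_leftMul_ann]
  · simp [contractionJet_leftMul_cre z hij]

lemma symbol_pderiv_symDelta_normalOrder_of_mem_wordsAt (hij : i ≠ j)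
    {B : FreeAlgebra ℂ (Gen ι)} (hB : B ∈ wordsAt j) :
    symbol z (MvPolynomial.pderiv (symDelta i j) (normalOrder B)) = 0 := by
  classical
  have h := congrArg TrivSqZeroExt.snd (contractionJet_lift_leftMul z hij.symm hB 1)
  simpa [contractionJet_apply, symDelta, Sym2.eq_swap, normalOrder] using h

/-- Of all contractions, exactly those of one `b_{t_i}` in `A` with one `b_{t_j}^†` in `B` produce
`δ(t_i - t_j)` to the first order. -/
theorem symbol_pderiv_symDelta_normalOrder_mul [DecidableEq (Gen ι)] (hij : i ≠ j)
    {A B : FreeAlgebra ℂ (Gen ι)} (hA : A ∈ wordsAt i) (hB : B ∈ wordsAt j) :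
    symbol z (MvPolynomial.pderiv (symDelta i j) (normalOrder (A * B))) =
      (FreeAlgebra.lift ℂ (inl ∘ z + Pi.single (Gen.ann i) eps : Gen ι → DualNumber ℂ) A).snd *
        (FreeAlgebra.lift ℂ (inl ∘ z + Pi.single (Gen.cre j) eps : Gen ι → DualNumber ℂ)
          B).snd := by
  have hjet := congrArg TrivSqZeroExt.snd (contractionJet_lift_leftMul z hij hA (normalOrder B))
  have hcre := snd_symbol_inl_add_single_eps z (Gen.cre j) (normalOrder B)
  rw [symbol_normalOrder] at hcre
  rw [contractionJet_apply, contractionJet_apply,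
    symbol_pderiv_symDelta_normalOrder_of_mem_wordsAt z hij hB] at hjet
  simpa [normalOrder, hcre, symCre] using hjet

end Contraction

/-! ### Normally convergent series of continuous functions -/

/-- `Φ` is the sum of the series of continuous functions `φ i`, and the series converges normally
on every compact set. -/
structure HasNormalSum {ι E F : Type*} [TopologicalSpace E] [NormedAddCommGroup F]
    (φ : ι → E → F) (Φ : E → F) : Prop where
  continuous (i : ι) : Continuous (φ i)
  hasSum (p : E) : HasSum (fun i => φ i p) (Φ p)
  exists_summable_norm_le {S : Set E} (hS : IsCompact S) :
    ∃ c : ι → ℝ, Summable c ∧ ∀ i, ∀ p ∈ S, ‖φ i p‖ ≤ c i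

namespace HasNormalSum

variable {ι κ E E' F : Type*} [TopologicalSpace E] [TopologicalSpace E'] {φ : ι → E → F}
  {Φ : E → F}

lemma comp [NormedAddCommGroup F] (h : HasNormalSum φ Φ) {w : E' → E} (hw : Continuous w) :
    HasNormalSum (fun i p => φ i (w p)) (fun p => Φ (w p)) where
  continuous i := (h.continuous i).comp hw
  hasSum p := h.hasSum (w p)
  exists_summable_norm_le hS := by
    obtain ⟨c, hc, hφ⟩ := h.exists_summable_norm_le (hS.image hw)
    exact ⟨c, hc, fun i p hp => hφ i (w p) (Set.mem_image_of_mem w hp)⟩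

lemma clm_comp {𝕜 G : Type*} [NontriviallyNormedField 𝕜] [NormedAddCommGroup F] [NormedSpace 𝕜 F]
    [NormedAddCommGroup G] [NormedSpace 𝕜 G] (L : F →L[𝕜] G) (h : HasNormalSum φ Φ) :
    HasNormalSum (fun i p => L (φ i p)) (fun p => L (Φ p)) where
  continuous i := L.continuous.comp (h.continuous i)
  hasSum p := L.hasSum (h.hasSum p)
  exists_summable_norm_le hS := by
    obtain ⟨c, hc, hφ⟩ := h.exists_summable_norm_le hS
    refine ⟨fun i => ‖L‖ * c i, hc.mul_left _, fun i p hp => ?_⟩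
    grw [L.le_opNorm, hφ i p hp]

lemma mul [NormedRing F] [CompleteSpace F] {ψ : κ → E → F} {Ψ : E → F} (h : HasNormalSum φ Φ)
    (h' : HasNormalSum ψ Ψ) :
    HasNormalSum (fun (i : ι × κ) p => φ i.1 p * ψ i.2 p) (fun p => Φ p * Ψ p) where
  continuous i := (h.continuous i.1).mul (h'.continuous i.2)
  hasSum p := by
    obtain ⟨c, hc, hφ⟩ := h.exists_summable_norm_le (isCompact_singleton (x := p))
    obtain ⟨d, hd, hψ⟩ := h'.exists_summable_norm_le (isCompact_singleton (x := p))
    have hφ' : Summable fun i => ‖φ i p‖ :=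
      hc.of_nonneg_of_le (fun _ => norm_nonneg _) fun i => hφ i p rfl
    have hψ' : Summable fun i => ‖ψ i p‖ :=
      hd.of_nonneg_of_le (fun _ => norm_nonneg _) fun i => hψ i p rfl
    have hmul := summable_mul_of_summable_norm hφ' hψ'
    simpa only using (h.hasSum p).mul (h'.hasSum p) hmul
  exists_summable_norm_le {S} hS := by
    rcases S.eq_empty_or_nonempty with rfl | ⟨p₀, hp₀⟩
    · exact ⟨0, summable_zero, by simp⟩
    obtain ⟨c, hc, hφ⟩ := h.exists_summable_norm_le hS
    obtain ⟨d, hd, hψ⟩ := h'.exists_summable_norm_le hS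
    have hc0 (i : ι) : 0 ≤ c i := (norm_nonneg _).trans (hφ i p₀ hp₀)
    have hd0 (i : κ) : 0 ≤ d i := (norm_nonneg _).trans (hψ i p₀ hp₀)
    refine ⟨fun i => c i.1 * d i.2, hc.mul_of_nonneg hd hc0 hd0, fun i p hp => ?_⟩
    have := hc0 i.1
    grw [norm_mul_le, hφ i.1 p hp, hψ i.2 p hp]

end HasNormalSum

/-! ### Symbols of the densities -/

section Density

variable {R : Type*} [CommRing R] [Algebra ℂ R]

/-- The value of `densityTerm` when `b_t` and `b_t^†` are replaced by the commuting elements `p.1`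
and `p.2`. -/
def densityTermSymbol (n : ℕ) (k : ℤ) (pq : ℕ × ℕ) (p : R × R) : R :=
  ((pq.1.factorial : ℂ)⁻¹ • (((k : ℂ) / 2) • (p.1 - p.2)) ^ pq.1) *
    ((1 / 2 : ℂ) • (p.1 + p.2)) ^ (n - 1) *
    ((pq.2.factorial : ℂ)⁻¹ • (((k : ℂ) / 2) • (p.1 - p.2)) ^ pq.2)

lemma lift_densityTerm {ι : Type} (z : Gen ι → R) (i : ι) (n : ℕ) (k : ℤ) (pq : ℕ × ℕ) :
    FreeAlgebra.lift ℂ z (densityTerm i n k pq) =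
      densityTermSymbol n k pq (z (Gen.ann i), z (Gen.cre i)) := by
  simp only [densityTerm, expTerm, ann, cre, densityTermSymbol, map_mul, map_smul, map_pow,
    map_sub, map_add, FreeAlgebra.lift_ι_apply]

lemma densityTerm_mem_wordsAt {ι : Type} (i : ι) (n : ℕ) (k : ℤ) (pq : ℕ × ℕ) :
    densityTerm i n k pq ∈ wordsAt i := by
  have ha : ann i ∈ wordsAt i := Algebra.subset_adjoin (Set.mem_image_of_mem _ (by simp))
  have hc : cre i ∈ wordsAt i := Algebra.subset_adjoin (Set.mem_image_of_mem _ (by simp))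
  have he (p : ℕ) : expTerm i k p ∈ wordsAt i :=
    Subalgebra.smul_mem _ (pow_mem (Subalgebra.smul_mem _ (sub_mem ha hc) _) _) _
  exact mul_mem (mul_mem (he _) (pow_mem (Subalgebra.smul_mem _ (add_mem ha hc) _) _)) (he _)

end Density

section NormedDensity

variable {R : Type*} [NormedCommRing R] [NormedAlgebra ℂ R]

/-- The symbol `e^{k(x - y)} ((x + y)/2)^{n-1}` of the density
`e^{(k/2)(b - b^†)} ((b + b^†)/2)^{n-1} e^{(k/2)(b - b^†)}`, as a function of the values
`p = (x, y)` of `b` and `b^†`. -/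
def densitySymbol (n : ℕ) (k : ℤ) (p : R × R) : R :=
  NormedSpace.exp (((k : ℂ) / 2) • (p.1 - p.2)) * ((1 / 2 : ℂ) • (p.1 + p.2)) ^ (n - 1) *
    NormedSpace.exp (((k : ℂ) / 2) • (p.1 - p.2))

lemma continuous_densitySymbol [CompleteSpace R] (n : ℕ) (k : ℤ) :
    Continuous (densitySymbol n k : R × R → R) := by
  let _ : NormedAlgebra ℚ R := NormedAlgebra.restrictScalars ℚ ℂ R
  have := NormedSpace.exp_continuous (𝔸 := R)
  unfold densitySymbol
  fun_prop

lemma exists_summable_norm_densityTermSymbol_le [NormOneClass R] (n : ℕ) (k : ℤ) (r : ℝ) :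
    ∃ c : ℕ × ℕ → ℝ, Summable c ∧
      ∀ (pq : ℕ × ℕ) (p : R × R), ‖p‖ ≤ r → ‖densityTermSymbol n k pq p‖ ≤ c pq := by
  set e := fun m : ℕ => (‖(k : ℂ) / 2‖ * (|r| + |r|)) ^ m / m.factorial
  have hsum : Summable e := Real.summable_pow_div_factorial _
  have hnonneg : 0 ≤ e := fun m => by positivity
  refine ⟨fun pq => e pq.1 * (‖(1 / 2 : ℂ)‖ * (|r| + |r|)) ^ (n - 1) * e pq.2,
    (hsum.mul_right _).mul_of_nonneg hsum (fun m => by positivity [hnonneg m]) hnonneg,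
    fun pq p hp => ?_⟩
  have hfst : ‖p.1‖ ≤ |r| := (norm_fst_le p).trans (hp.trans (le_abs_self r))
  have hsnd : ‖p.2‖ ≤ |r| := (norm_snd_le p).trans (hp.trans (le_abs_self r))
  have hexp (m : ℕ) : ‖(m.factorial : ℂ)⁻¹ • (((k : ℂ) / 2) • (p.1 - p.2)) ^ m‖ ≤ e m := by
    rw [norm_smul, norm_inv, Complex.norm_natCast, ← div_eq_inv_mul]
    grw [norm_pow_le, norm_smul, norm_sub_le, hfst, hsnd]
  have hpow : ‖((1 / 2 : ℂ) • (p.1 + p.2)) ^ (n - 1)‖ ≤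
      (‖(1 / 2 : ℂ)‖ * (|r| + |r|)) ^ (n - 1) := by
    grw [norm_pow_le, norm_smul, norm_add_le, hfst, hsnd]
  have := hnonneg pq.1
  rw [densityTermSymbol]
  grw [norm_mul_le, norm_mul_le, hexp, hexp, hpow]

lemma hasNormalSum_densityTermSymbol [NormOneClass R] [CompleteSpace R] (n : ℕ) (k : ℤ) :
    HasNormalSum (densityTermSymbol n k : ℕ × ℕ → R × R → R) (densitySymbol n k) where
  continuous pq := by
    unfold densityTermSymbol
    fun_prop
  hasSum p := by
    let e := ((k : ℂ) / 2) • (p.1 - p.2)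
    have hsum : HasSum (fun m : ℕ => (m.factorial : ℂ)⁻¹ • e ^ m) (NormedSpace.exp e) :=
      NormedSpace.exp_series_hasSum_exp' e
    have hnorm : Summable fun m : ℕ => ‖(m.factorial : ℂ)⁻¹ • e ^ m‖ :=
      NormedSpace.norm_expSeries_summable' e
    simp only [densityTermSymbol, densitySymbol, mul_right_comm _ (_ ^ (n - 1))]
    have hnorm_mul := summable_mul_of_summable_norm hnorm hnorm
    exact (hsum.mul hsum hnorm_mul).mul_right _
  exists_summable_norm_le hS := by
    obtain ⟨r, hr⟩ := hS.isBounded.exists_norm_le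
    obtain ⟨c, hc, hle⟩ := exists_summable_norm_densityTermSymbol_le (R := R) n k r
    exact ⟨c, hc, fun pq p hp => hle pq p (hr p hp)⟩

end NormedDensity

/-! ### The Poisson bracket of the symbols -/

/-- The point `p + (ε, 0)`, at which symbols have the infinitesimal part `∂/∂x`. -/
def annShift (p : ℂ × ℂ) : DualNumber ℂ × DualNumber ℂ := (inl p.1 + eps, inl p.2)

/-- The point `p + (0, ε)`, at which symbols have the infinitesimal part `∂/∂y`. -/
def creShift (p : ℂ × ℂ) : DualNumber ℂ × DualNumber ℂ := (inl p.1, inl p.2 + eps)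

lemma continuous_annShift : Continuous annShift := by
  have := TrivSqZeroExt.continuous_inl (R := ℂ) (M := ℂ)
  unfold annShift
  fun_prop

lemma continuous_creShift : Continuous creShift := by
  have := TrivSqZeroExt.continuous_inl (R := ℂ) (M := ℂ)
  unfold creShift
  fun_prop

lemma exp_eq_exp_half_mul_exp_half (c x : ℂ) :
    Complex.exp (c * x) = Complex.exp (c / 2 * x) * Complex.exp (c / 2 * x) := by
  rw [← Complex.exp_add, ← add_mul, add_halves]

lemma densitySymbol_apply (n : ℕ) (k : ℤ) (p : ℂ × ℂ) :
    densitySymbol n k p = Complex.exp (k * (p.1 - p.2)) * ((p.1 + p.2) / 2) ^ (n - 1) := by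
  simp only [densitySymbol, smul_eq_mul, ← Complex.exp_eq_exp_ℂ, exp_eq_exp_half_mul_exp_half k]
  ring

lemma snd_densitySymbol (n : ℕ) (k : ℤ) (q : DualNumber ℂ × DualNumber ℂ) :
    (densitySymbol n k q).snd = Complex.exp (k * (q.1.fst - q.2.fst)) *
      (k * ((q.1.fst + q.2.fst) / 2) ^ (n - 1) * (q.1.snd - q.2.snd) +
        (n - 1 : ℕ) * ((q.1.fst + q.2.fst) / 2) ^ (n - 2) * ((q.1.snd + q.2.snd) / 2)) := by
  simp only [densitySymbol, DualNumber.snd_mul, TrivSqZeroExt.fst_mul, TrivSqZeroExt.fst_exp,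
    TrivSqZeroExt.snd_exp, TrivSqZeroExt.fst_pow, TrivSqZeroExt.snd_pow, TrivSqZeroExt.fst_smul,
    TrivSqZeroExt.snd_smul, TrivSqZeroExt.fst_sub, TrivSqZeroExt.snd_sub, TrivSqZeroExt.fst_add,
    TrivSqZeroExt.snd_add, smul_eq_mul, nsmul_eq_mul, Nat.pred_eq_sub_one, Nat.sub_sub,
    Nat.reduceAdd, ← Complex.exp_eq_exp_ℂ, exp_eq_exp_half_mul_exp_half k]
  ring

theorem poissonBracket_densitySymbol {n N : ℕ} (hn : 1 ≤ n) (hN : 1 ≤ N) (k K : ℤ) (p : ℂ × ℂ) :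
    (densitySymbol n k (annShift p)).snd * (densitySymbol N K (creShift p)).snd -
        (densitySymbol N K (annShift p)).snd * (densitySymbol n k (creShift p)).snd =
      ((k : ℂ) * ((N : ℂ) - 1) - (K : ℂ) * ((n : ℂ) - 1)) *
        densitySymbol (n + N - 2) (k + K) p := by
  obtain ⟨a, rfl⟩ := Nat.exists_eq_add_of_le' hn
  obtain ⟨b, rfl⟩ := Nat.exists_eq_add_of_le' hN
  have hexp : Complex.exp ((k + K : ℤ) * (p.1 - p.2)) =
      Complex.exp (k * (p.1 - p.2)) * Complex.exp (K * (p.1 - p.2)) := by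
    rw [← Complex.exp_add, Int.cast_add, add_mul]
  have hpow (x : ℂ) (c d : ℕ) : (d : ℂ) * x ^ (c + d - 1) = d * (x ^ c * x ^ (d - 1)) := by
    obtain _ | d := d
    · simp
    · rw [Nat.add_succ_sub_one, Nat.succ_sub_one, pow_add]
  have hab := hpow ((p.1 + p.2) / 2) a b
  have hba := hpow ((p.1 + p.2) / 2) b a
  rw [add_comm b a] at hba
  simp only [snd_densitySymbol, densitySymbol_apply, annShift, creShift, TrivSqZeroExt.fst_add,
    TrivSqZeroExt.snd_add, TrivSqZeroExt.fst_inl, TrivSqZeroExt.snd_inl, DualNumber.fst_eps,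
    DualNumber.snd_eps, hexp, add_zero, zero_add, sub_zero, zero_sub,
    Nat.add_sub_cancel, show a + 1 + (b + 1) - 2 = a + b by omega, Nat.cast_add, Nat.cast_one,
    show a + 1 - 2 = a - 1 by omega, show b + 1 - 2 = b - 1 by omega]
  linear_combination
    (-Complex.exp (k * (p.1 - p.2)) * Complex.exp (K * (p.1 - p.2))) * (k * hab - K * hba)

/-! ### Integrals of series of continuous functions -/

/-- `F` is integrable and `w` maps its support into a compact set, so that `F · (φ ∘ w)` is
integrable for every continuous `φ`. -/
structure CompactlyIntegrable {α E : Type*} [MeasurableSpace α] [TopologicalSpace E] (F : α → ℂ)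
    (w : α → E) (μ : Measure α) : Prop where
  integrable : Integrable F μ
  aestronglyMeasurable : AEStronglyMeasurable w μ
  exists_isCompact : ∃ S, IsCompact S ∧ Set.MapsTo w (Function.support F) S

namespace CompactlyIntegrable

variable {α β E E' : Type*} [MeasurableSpace α] [MeasurableSpace β] [TopologicalSpace E]
  [TopologicalSpace E'] {F : α → ℂ} {G : β → ℂ} {w : α → E} {w' : β → E'} {μ : Measure α}
  {ν : Measure β}

lemma integrable_mul_comp (h : CompactlyIntegrable F w μ) {φ : E → ℂ} (hφ : Continuous φ) :
    Integrable (fun a => F a * φ (w a)) μ := by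
  obtain ⟨S, hS, hwS⟩ := h.exists_isCompact
  obtain ⟨C, hC⟩ := hS.exists_bound_of_continuousOn hφ.continuousOn
  refine (h.integrable.norm.mul_const C).mono' (h.integrable.aestronglyMeasurable.mul
    (hφ.comp_aestronglyMeasurable h.aestronglyMeasurable)) (.of_forall fun a => ?_)
  rw [norm_mul]
  by_cases ha : F a = 0
  · simp [ha]
  · grw [hC (w a) (hwS ha)]

lemma hasSum_integral_mul_comp {ι : Type*} [Countable ι] (h : CompactlyIntegrable F w μ)
    {φ : ι → E → ℂ} {Φ : E → ℂ} (hφ : HasNormalSum φ Φ) :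
    HasSum (fun i => ∫ a, F a * φ i (w a) ∂μ) (∫ a, F a * Φ (w a) ∂μ) := by
  obtain ⟨S, hS, hwS⟩ := h.exists_isCompact
  obtain ⟨c, hc, hle⟩ := hφ.exists_summable_norm_le hS
  have hint (i : ι) : Integrable (fun a => F a * φ i (w a)) μ :=
    h.integrable_mul_comp (hφ.continuous i)
  have hnorm (i : ι) : ∫ a, ‖F a * φ i (w a)‖ ∂μ ≤ (∫ a, ‖F a‖ ∂μ) * c i := by
    rw [← integral_mul_const]
    refine integral_mono (hint i).norm (h.integrable.norm.mul_const _) fun a => ?_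
    by_cases ha : F a = 0
    · simp [ha]
    · grw [norm_mul, hle i (w a) (hwS ha)]
  have hsum : Summable fun i => ∫ a, ‖F a * φ i (w a)‖ ∂μ :=
    (hc.mul_left _).of_nonneg_of_le (fun i => integral_nonneg fun a => norm_nonneg _) hnorm
  simpa only [tsum_mul_left, (hφ.hasSum _).tsum_eq] using
    hasSum_integral_of_summable_integral_norm hint hsum

lemma prod (h : CompactlyIntegrable F w μ) (h' : CompactlyIntegrable G w' ν) :
    CompactlyIntegrable (fun z : α × β => F z.1 * G z.2) (Prod.map w w') (μ.prod ν) where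
  integrable := h.integrable.mul_prod h'.integrable
  aestronglyMeasurable := h.aestronglyMeasurable.comp_fst.prodMk h'.aestronglyMeasurable.comp_snd
  exists_isCompact := by
    obtain ⟨S, hS, hwS⟩ := h.exists_isCompact
    obtain ⟨S', hS', hwS'⟩ := h'.exists_isCompact
    exact ⟨S ×ˢ S', hS.prod hS', fun z hz =>
      ⟨hwS (left_ne_zero_of_mul hz), hwS' (right_ne_zero_of_mul hz)⟩⟩

end CompactlyIntegrable

/-! ### Test functions -/

/-- Integrable test functions of bounded support that vanish at `0`, where the renormalization
concentrates all surplus delta factors. -/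
structure IsTestFun (f : ℝ → ℂ) : Prop where
  integrable : Integrable f
  isBounded_support : Bornology.IsBounded (Function.support f)
  map_zero : f 0 = 0

/-- The values of `b_t` and `b_t^†` between the exponential vectors `ψ(u)` and `ψ(v)`. -/
def expPoint (u v : ℝ → ℂ) (t : ℝ) : ℂ × ℂ := (v t, conj (u t))

lemma IsTestFun.mul_right {f : ℝ → ℂ} (hf : IsTestFun f) {h : ℝ → ℂ}
    (hfh : Integrable fun t => f t * h t) : IsTestFun fun t => f t * h t where
  integrable := hfh
  isBounded_support := hf.isBounded_support.subset (Function.support_mul_subset_left f h)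
  map_zero := by rw [hf.map_zero, zero_mul]

lemma IsTestFun.compactlyIntegrable {f u v : ℝ → ℂ} (hf : IsTestFun f) (hu : IsExpArg u)
    (hv : IsExpArg v) : CompactlyIntegrable f (expPoint u v) volume where
  integrable := hf.integrable
  aestronglyMeasurable :=
    (hv.1.prodMk (Complex.continuous_conj.measurable.comp hu.1)).aestronglyMeasurable
  exists_isCompact := by
    obtain ⟨R, hR⟩ := hf.isBounded_support.exists_norm_le
    obtain ⟨C, hC⟩ := hu.2.2 R
    obtain ⟨D, hD⟩ := hv.2.2 R
    refine ⟨Metric.closedBall 0 (max D C), isCompact_closedBall _ _, fun t ht => ?_⟩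
    rw [mem_closedBall_zero_iff, expPoint, Prod.norm_mk, RCLike.norm_conj]
    exact max_le_max (hD t (hR t ht)) (hC t (hR t ht))

/-! ### Forms of normally ordered expressions -/

lemma annihilate_smul (t : ℝ) (c : ℂ) (ψ : FockVec) :
    annihilate t (c • ψ) = c • annihilate t ψ := by
  ext n s
  simp only [annihilate, Pi.smul_apply, smul_eq_mul]
  ring

lemma annihilate_expVec (t : ℝ) (u : ℝ → ℂ) : annihilate t (expVec u) = u t • expVec u := by
  ext n s
  have hn : (Real.sqrt ((n : ℝ) + 1) : ℂ) ≠ 0 := by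
    exact_mod_cast (Real.sqrt_pos.2 (by positivity)).ne'
  have hfactorial : (Real.sqrt ((n + 1).factorial : ℝ) : ℂ) =
      (Real.sqrt ((n : ℝ) + 1) : ℂ) * (Real.sqrt (n.factorial : ℝ) : ℂ) := by
    rw [Nat.factorial_succ, Nat.cast_mul, Real.sqrt_mul (by positivity)]
    push_cast
    rfl
  simp only [annihilate, expVec, Pi.smul_apply, smul_eq_mul, Fin.prod_univ_succ, Fin.cons_zero,
    Fin.cons_succ, hfactorial]
  field_simp

lemma iterate_annihilate_smul_expVec (t : ℝ) (u : ℝ → ℂ) (c : ℂ) (a : ℕ) :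
    (annihilate t)^[a] (c • expVec u) = (u t ^ a * c) • expVec u := by
  induction a with
  | zero => simp
  | succ a ih =>
    rw [Function.iterate_succ_apply', ih, annihilate_smul, annihilate_expVec, smul_smul, pow_succ']
    ring_nf

lemma iterate_annihilate_expVec (t : ℝ) (u : ℝ → ℂ) (a : ℕ) :
    (annihilate t)^[a] (expVec u) = u t ^ a • expVec u := by
  simpa only [one_smul, mul_one] using iterate_annihilate_smul_expVec t u 1 a

lemma fockInner_smul_smul (c d : ℂ) (ψ φ : FockVec) :
    fockInner (c • ψ) (d • φ) = conj c * d * fockInner ψ φ := by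
  simp only [fockInner, Pi.smul_apply, smul_eq_mul, map_mul, ← tsum_mul_left,
    ← integral_const_mul]
  congr! 4
  ring

lemma integral_renormFactor {φ : ℝ → ℂ} (hφ : φ 0 = 0) (m : ℕ) :
    ∫ t, φ t ∂(renormFactor m) = (∫ t, φ t) * 0 ^ m := by
  rcases eq_or_ne m 0 with rfl | hm
  · simp [renormFactor]
  · simp [renormFactor, hm, hφ]

/-- The values of the letters when `p i` are the values of `b_{t_i}` and `b_{t_i}^†`. -/
def letterValue {ι : Type} (p : ι → ℂ × ℂ) : Gen ι → ℂ
  | Gen.ann i => (p i).1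
  | Gen.cre i => (p i).2

lemma continuous_symbol_letterValue {ι : Type} (P : NormalExpr ι) :
    Continuous fun p : ι → ℂ × ℂ => symbol (letterValue p) P := by
  have hletters : Continuous fun p : ι → ℂ × ℂ => (Sum.elim (letterValue p) 0 : Var ι → ℂ) := by
    refine continuous_pi fun x => ?_
    rcases x with (i | i) | e <;> simp only [Sum.elim_inl, Sum.elim_inr, letterValue] <;> fun_prop
  simpa only [symbol, MvPolynomial.aeval_eq_eval, Function.comp_def] using!
    (MvPolynomial.continuous_eval P).comp hletters

/-- The product of the letters of the monomial with exponents `d` at the values `p`. -/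
def letterProd {ι : Type} [Fintype ι] (p : ι → ℂ × ℂ) (d : Var ι →₀ ℕ) : ℂ :=
  ∏ i, (p i).1 ^ d (symAnn i) * (p i).2 ^ d (symCre i)

/-- Every letter is an annihilator or a creator. -/
def sumEquivGen (ι : Type) : ι ⊕ ι ≃ Gen ι where
  toFun := Sum.elim Gen.ann Gen.cre
  invFun
    | Gen.ann i => Sum.inl i
    | Gen.cre i => Sum.inr i
  left_inv := by rintro (i | i) <;> rfl
  right_inv := by rintro (i | i) <;> rfl

lemma symbol_monomial {ι : Type} [Fintype ι] (p : ι → ℂ × ℂ) (d : Var ι →₀ ℕ) :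
    symbol (letterValue p) (MvPolynomial.monomial d 1) =
      letterProd p d * 0 ^ ∑ e : Sym2 ι, d (Sum.inr e) := by
  let _ : Fintype (Gen ι) := Fintype.ofEquiv _ (sumEquivGen ι)
  rw [symbol, MvPolynomial.aeval_monomial, Finsupp.prod_fintype _ _ (by simp),
    Fintype.prod_sum_type, ← (sumEquivGen ι).prod_comp, Fintype.prod_sum_type,
    ← Finset.prod_mul_distrib, ← Finset.prod_pow_eq_pow_sum, map_one, one_mul]
  rfl

lemma univ_sym2_fin_two : (Finset.univ : Finset (Sym2 (Fin 2))) = {s(0, 0), s(0, 1), s(1, 1)} := by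
  decide

lemma symbol_monomial_fin_one (p : Fin 1 → ℂ × ℂ) (d : Var (Fin 1) →₀ ℕ) :
    symbol (letterValue p) (MvPolynomial.monomial d 1) =
      letterProd p d * 0 ^ d (symDelta 0 0) := by
  rw [symbol_monomial, Fintype.sum_unique]
  rfl

lemma symbol_monomial_fin_two (p : Fin 2 → ℂ × ℂ) (d : Var (Fin 2) →₀ ℕ) :
    symbol (letterValue p) (MvPolynomial.monomial d 1) =
      letterProd p d * 0 ^ (d (symDelta 0 0) + d (symDelta 1 1) + d (symDelta 0 1)) := by
  rw [symbol_monomial, univ_sym2_fin_two, Finset.sum_insert (by decide),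
    Finset.sum_insert (by decide), Finset.sum_singleton, add_right_comm, ← add_assoc]
  rfl

lemma symbol_pderiv_symDelta_monomial (p : Fin 2 → ℂ × ℂ) (d : Var (Fin 2) →₀ ℕ) :
    symbol (letterValue p)
        (MvPolynomial.pderiv (symDelta 0 1) (MvPolynomial.monomial d 1)) =
      if d (symDelta 0 1) = 0 then 0
      else letterProd p d * 0 ^ (d (symDelta 0 0) + d (symDelta 1 1) + d (symDelta 0 1) - 1) := by
  classical
  set d' := d - Finsupp.single (symDelta 0 1) 1 with hd'
  have hletters : letterProd p d' = letterProd p d := by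
    simp [hd', letterProd, symAnn, symCre, symDelta]
  have hsmul : MvPolynomial.monomial d' (d (symDelta 0 1) : ℂ) =
      (d (symDelta 0 1) : ℂ) • MvPolynomial.monomial d' 1 := by
    rw [MvPolynomial.smul_monomial, smul_eq_mul, mul_one]
  rw [MvPolynomial.pderiv_monomial, one_mul, ← hd', hsmul, map_smul, smul_eq_mul,
    symbol_monomial_fin_two, hletters]
  split_ifs with hd
  · rw [hd, Nat.cast_zero, zero_mul]
  · have h00 : d' (symDelta 0 0) = d (symDelta 0 0) := by simp [hd', symDelta]
    have h11 : d' (symDelta 1 1) = d (symDelta 1 1) := by simp [hd', symDelta]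
    have h01 : d' (symDelta 0 1) = d (symDelta 0 1) - 1 := by simp [hd']
    rw [h00, h11, h01, ← Nat.add_sub_assoc (Nat.pos_of_ne_zero hd)]
    rcases eq_or_ne (d (symDelta 0 0) + d (symDelta 1 1) + d (symDelta 0 1) - 1) 0 with h0 | h0
    · rw [show d (symDelta 0 1) = 1 by omega, Nat.cast_one, one_mul]
    · rw [zero_pow h0, mul_zero, mul_zero]

section ExpVec

variable {f h u v : ℝ → ℂ}

lemma monomialForm₁_expVec (hf : f 0 = 0) (d : Var (Fin 1) →₀ ℕ) :
    monomialForm₁ f (expVec u) (expVec v) d = fockInner (expVec u) (expVec v) *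
      ∫ t, f t * symbol (letterValue fun _ => expPoint u v t) (MvPolynomial.monomial d 1) := by
  rw [monomialForm₁, integral_renormFactor (by rw [hf, zero_mul]), ← integral_mul_const,
    ← integral_const_mul]
  refine integral_congr_ae (.of_forall fun t => ?_)
  simp only [iterate_annihilate_expVec, fockInner_smul_smul, symbol_monomial_fin_one, letterProd,
    Fin.prod_univ_one, expPoint, map_pow]
  ring

lemma twoTimeForm_expVec (d : Var (Fin 2) →₀ ℕ) (t s : ℝ) :
    twoTimeForm (expVec u) (expVec v) d t s =
      fockInner (expVec u) (expVec v) * letterProd ![expPoint u v t, expPoint u v s] d := by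
  simp only [twoTimeForm, iterate_annihilate_expVec, iterate_annihilate_smul_expVec,
    fockInner_smul_smul, letterProd, Fin.prod_univ_two, Matrix.cons_val_zero, Matrix.cons_val_one,
    expPoint, map_mul, map_pow]
  ring

lemma integral_integral_renormFactor {φ : ℝ × ℝ → ℂ} (hφ : Integrable φ (volume.prod volume))
    (hφ₁ : ∀ s, φ (0, s) = 0) (hφ₂ : ∀ t, φ (t, 0) = 0) (l m : ℕ) :
    ∫ t, ∫ s, φ (t, s) ∂(renormFactor m) ∂(renormFactor l) = (∫ z, φ z) * 0 ^ (l + m) := by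
  simp only [fun t => integral_renormFactor (φ := fun s => φ (t, s)) (hφ₂ t) m]
  rw [integral_renormFactor (by simp only [hφ₁, integral_zero, zero_mul]), integral_mul_const,
    Measure.volume_eq_prod, integral_prod _ hφ, pow_add, mul_assoc, mul_comm (0 ^ m)]

lemma monomialForm₂_expVec (hf : IsTestFun f) (hh : IsTestFun h) (hu : IsExpArg u)
    (hv : IsExpArg v) (d : Var (Fin 2) →₀ ℕ) :
    monomialForm₂ f h (expVec u) (expVec v) d = fockInner (expVec u) (expVec v) *
      ((∫ z : ℝ × ℝ, f z.1 * h z.2 *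
          symbol (letterValue ![expPoint u v z.1, expPoint u v z.2]) (MvPolynomial.monomial d 1)) +
        ∫ s, f s * h s * symbol (letterValue ![expPoint u v s, expPoint u v s])
          (MvPolynomial.pderiv (symDelta 0 1) (MvPolynomial.monomial d 1))) := by
  simp only [monomialForm₂, twoTimeForm_expVec, symbol_monomial_fin_two,
    symbol_pderiv_symDelta_monomial]
  split_ifs with hd
  · have hcont : Continuous fun q : (ℂ × ℂ) × (ℂ × ℂ) =>
        fockInner (expVec u) (expVec v) * letterProd ![q.1, q.2] d := by
      unfold letterProd
      fun_prop
    have hint := ((hf.compactlyIntegrable hu hv).prod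
      (hh.compactlyIntegrable hu hv)).integrable_mul_comp hcont
    have h := integral_integral_renormFactor hint (by simp [hf.map_zero]) (by simp [hh.map_zero])
      (d (symDelta 0 0)) (d (symDelta 1 1))
    simp only [Prod.map_fst, Prod.map_snd] at h
    rw [h, hd, ← integral_mul_const]
    simp only [mul_zero, integral_zero, add_zero, ← integral_const_mul]
    congr! 2
    ring
  · have hpow : (0 : ℂ) ^ (d (symDelta 0 0) + d (symDelta 1 1) + d (symDelta 0 1)) = 0 :=
      zero_pow (by omega)
    rw [integral_renormFactor (by simp only [hf.map_zero, zero_mul]), ← integral_mul_const]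
    simp only [hpow, mul_zero, integral_zero, zero_add, ← integral_const_mul]
    congr! 2
    ring

lemma CompactlyIntegrable.integral_mul_symbol {α E ι : Type} [MeasurableSpace α]
    [TopologicalSpace E] {F : α → ℂ} {w : α → E} {μ : Measure α} (hF : CompactlyIntegrable F w μ)
    {e : E → ι → ℂ × ℂ} (he : Continuous e) (D : NormalExpr ι →ₗ[ℂ] NormalExpr ι)
    (P : NormalExpr ι) :
    ∫ a, F a * symbol (letterValue (e (w a))) (D P) ∂μ = ∑ d ∈ P.support, P.coeff d *
      ∫ a, F a * symbol (letterValue (e (w a))) (D (MvPolynomial.monomial d 1)) ∂μ := by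
  have hsymbol (z : Gen ι → ℂ) : symbol z (D P) =
      ∑ d ∈ P.support, P.coeff d * symbol z (D (MvPolynomial.monomial d 1)) := by
    conv_lhs => rw [P.as_sum]
    simp only [map_sum]
    refine Finset.sum_congr rfl fun d _ => ?_
    rw [← smul_eq_mul, ← map_smul, ← map_smul, MvPolynomial.smul_monomial, smul_eq_mul, mul_one]
  simp only [hsymbol, Finset.mul_sum, mul_left_comm (F _)]
  rw [integral_finsetSum]
  · simp only [integral_const_mul]
  · exact fun d _ => (hF.integrable_mul_comp
      ((continuous_symbol_letterValue _).comp he)).const_mul _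

lemma exprForm₁_expVec (hf : IsTestFun f) (hu : IsExpArg u) (hv : IsExpArg v)
    (P : NormalExpr (Fin 1)) :
    exprForm₁ f P (expVec u) (expVec v) = fockInner (expVec u) (expVec v) *
      ∫ t, f t * symbol (letterValue fun _ => expPoint u v t) P := by
  have hconst : Continuous fun (q : ℂ × ℂ) (_ : Fin 1) => q := by fun_prop
  have h := (hf.compactlyIntegrable hu hv).integral_mul_symbol hconst .id P
  simp only [LinearMap.id_apply] at h
  simp only [exprForm₁, monomialForm₁_expVec hf.map_zero, h, Finset.mul_sum, mul_left_comm]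

lemma exprForm₂_expVec (hf : IsTestFun f) (hh : IsTestFun h) (hfh : Integrable fun t => f t * h t)
    (hu : IsExpArg u) (hv : IsExpArg v) (P : NormalExpr (Fin 2)) :
    exprForm₂ f h P (expVec u) (expVec v) = fockInner (expVec u) (expVec v) *
      ((∫ z : ℝ × ℝ, f z.1 * h z.2 *
          symbol (letterValue ![expPoint u v z.1, expPoint u v z.2]) P) +
        ∫ s, f s * h s * symbol (letterValue ![expPoint u v s, expPoint u v s])
          (MvPolynomial.pderiv (symDelta 0 1) P)) := by
  have hpair : Continuous fun q : (ℂ × ℂ) × (ℂ × ℂ) => ![q.1, q.2] := by fun_prop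
  have hdiag : Continuous fun q : ℂ × ℂ => ![q, q] := by fun_prop
  have htwo := ((hf.compactlyIntegrable hu hv).prod
    (hh.compactlyIntegrable hu hv)).integral_mul_symbol hpair .id P
  have hone := ((hf.mul_right hfh).compactlyIntegrable hu hv).integral_mul_symbol hdiag
    (MvPolynomial.pderiv (symDelta 0 1)).toLinearMap P
  simp only [LinearMap.id_apply, Prod.map_fst, Prod.map_snd, ← Measure.volume_eq_prod] at htwo
  simp only [Derivation.coeFn_coe] at hone
  rw [htwo, hone, ← Finset.sum_add_distrib, Finset.mul_sum, exprForm₂]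
  refine Finset.sum_congr rfl fun d _ => ?_
  rw [monomialForm₂_expVec hf hh hu hv]
  ring

/-! ### Summation of the exponential series -/

lemma BhatTerm_expVec (hf : IsTestFun f) (hu : IsExpArg u) (hv : IsExpArg v) (n : ℕ) (k : ℤ)
    (pq : ℕ × ℕ) :
    BhatTerm n k f (expVec u) (expVec v) pq = fockInner (expVec u) (expVec v) *
      ∫ t, f t * densityTermSymbol n k pq (expPoint u v t) := by
  simp only [BhatTerm, exprForm₁_expVec hf hu hv, symbol_normalOrder, lift_densityTerm,
    letterValue]

lemma hasSum_BhatTerm (hf : IsTestFun f) (hu : IsExpArg u) (hv : IsExpArg v) (n : ℕ) (k : ℤ) :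
    HasSum (BhatTerm n k f (expVec u) (expVec v)) (fockInner (expVec u) (expVec v) *
      ∫ t, f t * densitySymbol n k (expPoint u v t)) := by
  rw [funext (BhatTerm_expVec hf hu hv n k)]
  exact ((hf.compactlyIntegrable hu hv).hasSum_integral_mul_comp
    (hasNormalSum_densityTermSymbol n k)).mul_left _

lemma symbol_pderiv_symDelta_densityTerm_mul (p : ℂ × ℂ) (n N : ℕ) (k K : ℤ)
    (r : (ℕ × ℕ) × (ℕ × ℕ)) :
    symbol (letterValue ![p, p]) (MvPolynomial.pderiv (symDelta 0 1)
        (normalOrder (densityTerm 0 n k r.1 * densityTerm 1 N K r.2))) =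
      (densityTermSymbol n k r.1 (annShift p)).snd *
        (densityTermSymbol N K r.2 (creShift p)).snd := by
  classical
  rw [symbol_pderiv_symDelta_normalOrder_mul _ (by decide) (densityTerm_mem_wordsAt 0 n k r.1)
    (densityTerm_mem_wordsAt 1 N K r.2), lift_densityTerm, lift_densityTerm]
  simp [letterValue, annShift, creShift]

lemma BhatMulTerm_expVec (hf : IsTestFun f) (hh : IsTestFun h)
    (hfh : Integrable fun t => f t * h t) (hu : IsExpArg u) (hv : IsExpArg v) (n N : ℕ) (k K : ℤ)
    (r : (ℕ × ℕ) × (ℕ × ℕ)) :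
    BhatMulTerm n k f N K h (expVec u) (expVec v) r = fockInner (expVec u) (expVec v) *
      ((∫ z : ℝ × ℝ, f z.1 * h z.2 * (densityTermSymbol n k r.1 (expPoint u v z.1) *
          densityTermSymbol N K r.2 (expPoint u v z.2))) +
        ∫ s, f s * h s * ((densityTermSymbol n k r.1 (annShift (expPoint u v s))).snd *
          (densityTermSymbol N K r.2 (creShift (expPoint u v s))).snd)) := by
  simp only [BhatMulTerm, exprForm₂_expVec hf hh hfh hu hv, symbol_normalOrder, map_mul,
    lift_densityTerm, letterValue, symbol_pderiv_symDelta_densityTerm_mul, Matrix.cons_val_zero,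
    Matrix.cons_val_one]

lemma hasNormalSum_snd_densityTermSymbol {w : ℂ × ℂ → DualNumber ℂ × DualNumber ℂ}
    (hw : Continuous w) (n : ℕ) (k : ℤ) :
    HasNormalSum (fun pq p => (densityTermSymbol n k pq (w p)).snd)
      (fun p => (densitySymbol n k (w p)).snd) :=
  ((hasNormalSum_densityTermSymbol n k).clm_comp (TrivSqZeroExt.sndCLM ℂ ℂ)).comp hw

lemma hasSum_BhatMulTerm (hf : IsTestFun f) (hh : IsTestFun h)
    (hfh : Integrable fun t => f t * h t) (hu : IsExpArg u) (hv : IsExpArg v) (n N : ℕ)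
    (k K : ℤ) :
    HasSum (BhatMulTerm n k f N K h (expVec u) (expVec v)) (fockInner (expVec u) (expVec v) *
      ((∫ t, f t * densitySymbol n k (expPoint u v t)) *
          (∫ s, h s * densitySymbol N K (expPoint u v s)) +
        ∫ s, f s * h s * ((densitySymbol n k (annShift (expPoint u v s))).snd *
          (densitySymbol N K (creShift (expPoint u v s))).snd))) := by
  have htwo := ((hf.compactlyIntegrable hu hv).prod
    (hh.compactlyIntegrable hu hv)).hasSum_integral_mul_comp
      (((hasNormalSum_densityTermSymbol n k).comp continuous_fst).mul
        ((hasNormalSum_densityTermSymbol N K).comp continuous_snd))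
  have hone := ((hf.mul_right hfh).compactlyIntegrable hu hv).hasSum_integral_mul_comp
    ((hasNormalSum_snd_densityTermSymbol continuous_annShift n k).mul
      (hasNormalSum_snd_densityTermSymbol continuous_creShift N K))
  rw [funext (BhatMulTerm_expVec hf hh hfh hu hv n N k K), ← integral_prod_mul]
  simp only [mul_mul_mul_comm (f _)]
  have hsum := (htwo.add hone).mul_left (fockInner (expVec u) (expVec v))
  simpa only [Prod.map_fst, Prod.map_snd, mul_mul_mul_comm (f _)] using! hsum

lemma BhatComm_expVec (hf : IsTestFun f) (hh : IsTestFun h)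
    (hfh : Integrable fun t => f t * h t) (hu : IsExpArg u) (hv : IsExpArg v) {n N : ℕ}
    (hn : 1 ≤ n) (hN : 1 ≤ N) (k K : ℤ) :
    BhatComm n k f N K h (expVec u) (expVec v) =
      ((k : ℂ) * ((N : ℂ) - 1) - (K : ℂ) * ((n : ℂ) - 1)) *
        Bhat (n + N - 2) (k + K) (fun t => f t * h t) (expVec u) (expVec v) := by
  have hhf : Integrable fun t => h t * f t := by simpa only [mul_comm] using hfh
  have hsnd (m : ℕ) (l : ℤ) {w : ℂ × ℂ → DualNumber ℂ × DualNumber ℂ} (hw : Continuous w) :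
      Continuous fun p => (densitySymbol m l (w p)).snd :=
    TrivSqZeroExt.continuous_snd.comp ((continuous_densitySymbol m l).comp hw)
  have hint (m M : ℕ) (l L : ℤ) : Integrable fun s => f s * h s *
      ((densitySymbol m l (annShift (expPoint u v s))).snd *
        (densitySymbol M L (creShift (expPoint u v s))).snd) :=
    ((hf.mul_right hfh).compactlyIntegrable hu hv).integrable_mul_comp
      ((hsnd m l continuous_annShift).mul (hsnd M L continuous_creShift))
  rw [BhatComm, BhatMul, BhatMul, Bhat, (hasSum_BhatMulTerm hf hh hfh hu hv n N k K).tsum_eq,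
    (hasSum_BhatMulTerm hh hf hhf hu hv N n K k).tsum_eq,
    (hasSum_BhatTerm (hf.mul_right hfh) hu hv (n + N - 2) (k + K)).tsum_eq, ← mul_sub,
    mul_comm (∫ s, h s * _), add_sub_add_left_eq_sub]
  simp only [mul_comm (h _)]
  rw [← integral_sub (hint ..) (hint ..), mul_left_comm]
  congr 1
  rw [← integral_const_mul]
  congr 1 with s
  linear_combination (f s * h s) * poissonBracket_densitySymbol hn hN k K (expPoint u v s)

end ExpVec

/-! ### Step functions -/

lemma IsRightContStep.memLp {f : ℝ → ℂ} (hf : IsRightContStep f) (p : ENNReal) : MemLp f p := by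
  induction hf using Submodule.span_induction with
  | mem f hf =>
    obtain ⟨a, b, rfl⟩ := hf
    exact memLp_indicator_const p measurableSet_Ico 1 (.inr measure_Ico_lt_top.ne)
  | zero => exact MemLp.zero'
  | add f g _ _ hf hg => exact hf.add hg
  | smul c f _ hf => exact hf.const_smul c

lemma IsRightContStep.isBounded_support {f : ℝ → ℂ} (hf : IsRightContStep f) :
    Bornology.IsBounded (Function.support f) := by
  induction hf using Submodule.span_induction with
  | mem f hf =>
    obtain ⟨a, b, rfl⟩ := hf
    exact (Metric.isBounded_Ico a b).subset Set.support_indicator_subset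
  | zero => simp
  | add f g _ _ hf hg => exact (hf.union hg).subset (Function.support_add f g)
  | smul c f _ hf => exact hf.subset (Function.support_const_smul_subset c f)

lemma IsRightContStep.isTestFun {f : ℝ → ℂ} (hf : IsRightContStep f) (hf0 : f 0 = 0) :
    IsTestFun f where
  integrable := memLp_one_iff_integrable.1 (hf.memLp 1)
  isBounded_support := hf.isBounded_support
  map_zero := hf0

lemma IsRightContStep.star {f : ℝ → ℂ} (hf : IsRightContStep f) :
    IsRightContStep fun t => star (f t) := by
  induction hf using Submodule.span_induction with
  | mem f hf =>
    obtain ⟨a, b, rfl⟩ := hf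
    refine Submodule.subset_span ⟨a, b, funext fun t => ?_⟩
    by_cases ht : t ∈ Set.Ico a b <;> simp [ht]
  | zero => simpa only [Pi.zero_apply, star_zero] using!
      Submodule.zero_mem (R := ℂ) (M := ℝ → ℂ) _
  | add f g _ _ hf hg => simpa using! Submodule.add_mem _ hf hg
  | smul c f _ hf => simpa using! Submodule.smul_mem _ (Star.star c) hf

lemma IsRightContStep.integrable_mul {f g : ℝ → ℂ} (hf : IsRightContStep f)
    (hg : IsRightContStep g) : Integrable fun t => f t * g t :=
  (hf.memLp 2).integrable_mul (hg.memLp 2)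

end WhiteNoise

end

open WhiteNoise in
theorem proposition4_general {f h : ℝ → ℂ} (hf : IsTestFun f) (hh : IsTestFun h)
    (hfh : MeasureTheory.Integrable fun t => f t * h t) {n N : ℕ} (hn : 1 ≤ n) (hN : 1 ≤ N)
    (k K : ℤ) {u v : ℝ → ℂ} (hu : IsExpArg u) (hv : IsExpArg v) :
    Summable (BhatTerm n k f (expVec u) (expVec v)) ∧
    Summable (BhatTerm N K h (expVec u) (expVec v)) ∧
    Summable (BhatTerm (n + N - 2) (k + K) (fun t => f t * h t) (expVec u) (expVec v)) ∧
    Summable (BhatMulTerm n k f N K h (expVec u) (expVec v)) ∧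
    Summable (BhatMulTerm N K h n k f (expVec u) (expVec v)) ∧
    BhatComm n k f N K h (expVec u) (expVec v) =
      ((k : ℂ) * ((N : ℂ) - 1) - (K : ℂ) * ((n : ℂ) - 1)) *
        Bhat (n + N - 2) (k + K) (fun t => f t * h t) (expVec u) (expVec v) :=
  have hhf : MeasureTheory.Integrable fun t => h t * f t := by simpa only [mul_comm] using hfh
  ⟨(hasSum_BhatTerm hf hu hv n k).summable, (hasSum_BhatTerm hh hu hv N K).summable,
    (hasSum_BhatTerm (hf.mul_right hfh) hu hv _ _).summable,
    (hasSum_BhatMulTerm hf hh hfh hu hv n N k K).summable,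
    (hasSum_BhatMulTerm hh hf hhf hu hv N n K k).summable,
    BhatComm_expVec hf hh hfh hu hv hn hN k K⟩

theorem proposition4 (f g : ℝ → ℂ)
    (hf : WhiteNoise.IsRightContStep f) (hg : WhiteNoise.IsRightContStep g)
    (hf0 : f 0 = 0) (hg0 : g 0 = 0) :
    (∀ (n N : ℕ) (k K : ℤ), 2 ≤ n → 2 ≤ N →
      ∀ u v : ℝ → ℂ, WhiteNoise.IsExpArg u → WhiteNoise.IsExpArg v →
        Summable (WhiteNoise.BhatTerm n k (fun t => star (g t))
          (WhiteNoise.expVec u) (WhiteNoise.expVec v)) ∧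
        Summable (WhiteNoise.BhatTerm N K f
          (WhiteNoise.expVec u) (WhiteNoise.expVec v)) ∧
        Summable (WhiteNoise.BhatTerm (n + N - 2) (k + K) (fun t => star (g t) * f t)
          (WhiteNoise.expVec u) (WhiteNoise.expVec v)) ∧
        Summable (WhiteNoise.BhatMulTerm n k (fun t => star (g t)) N K f
          (WhiteNoise.expVec u) (WhiteNoise.expVec v)) ∧
        Summable (WhiteNoise.BhatMulTerm N K f n k (fun t => star (g t))
          (WhiteNoise.expVec u) (WhiteNoise.expVec v)) ∧
        WhiteNoise.BhatComm n k (fun t => star (g t)) N K f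
            (WhiteNoise.expVec u) (WhiteNoise.expVec v) =
          ((k : ℂ) * ((N : ℂ) - 1) - (K : ℂ) * ((n : ℂ) - 1)) *
            WhiteNoise.Bhat (n + N - 2) (k + K) (fun t => star (g t) * f t)
              (WhiteNoise.expVec u) (WhiteNoise.expVec v)) ∧
    (∀ (k K : ℤ) (u v : ℝ → ℂ), WhiteNoise.IsExpArg u → WhiteNoise.IsExpArg v →
        WhiteNoise.BhatComm 2 k (fun t => star (g t)) 2 K f
            (WhiteNoise.expVec u) (WhiteNoise.expVec v) =
          ((k : ℂ) - (K : ℂ)) *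
            WhiteNoise.Bhat 2 (k + K) (fun t => star (g t) * f t)
              (WhiteNoise.expVec u) (WhiteNoise.expVec v)) := by
  have hf' := hf.isTestFun hf0
  have hg' := hg.star.isTestFun (by rw [hg0, star_zero])
  have hgf := hg.star.integrable_mul hf
  refine ⟨fun n N k K hn hN u v hu hv => proposition4_general hg' hf' hgf (by omega) (by omega) k K
    hu hv, fun k K u v hu hv => ?_⟩
  obtain ⟨-, -, -, -, -, hcomm⟩ :=
    proposition4_general hg' hf' hgf one_le_two one_le_two k K hu hv
  have hcoeff : (k : ℂ) * ((2 : ℕ) - 1) - K * ((2 : ℕ) - 1) = k - K := by norm_num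
  rwa [hcoeff] at hcomm
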